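/- Fix a first-order signature consisting of finitely many predicate symbols (each with an arity) and finitely many constants, without function symbols. A term is a variable or a constant. A \emph{conjunctive formula} is a finite set of atoms, read as their conjunction (the empty set is $\top$); $\mathrm{vars}(\cdot)$ denotes the set of variables that occur. Two variables of a conjunctive formula $F$ are \emph{connected} in $F$ if they are related by the transitive closure of the relation ``occur together in some atom of $F$''. A conjunctive formula is connected if it is a single atom without variables, or if it is nonempty, each of its atoms contains a variable, and all its variables are connected to each other in it. The \emph{connected components} of $F$ are its maximal connected subsets. An \emph{existential rule} is a closed formula $\forall \vec X\,\exists \vec Y\; B\rightarrow H$, where the body $B$ and the head $H$ are conjunctive formulas, $\vec X=\mathrm{vars}(B)$ and $\vec Y=\mathrm{vars}(H)\setminus\mathrm{vars}(B)$. It is \emph{connected domain restricted} (cdr) if for every connected component $C$ of $B$ and every atom $h\in H$, either $\mathrm{vars}(C)\cap\mathrm{vars}(h)=\emptyset$ or $\mathrm{vars}(C)\subseteq\mathrm{vars}(h)$. A \emph{fact} and a (Boolean) \emph{conjunctive query} (CQ) are conjunctive formulas all of whose variables are existentially quantified; a \emph{union of conjunctive queries} (UCQ) is a finite set of CQs, read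 as their disjunction (the empty set is $\bot$). Let $\models$ be first-order entailment. A set $\mathcal R$ of existential rules is a \emph{finite unification set} (fus) if every UCQ $\mathcal Q$ has a finite and complete UCQ-rewriting with respect to $\mathcal R$, that is, if for every UCQ $\mathcal Q$ there is a UCQ $\mathcal Q'$ such that for every set $\mathcal D$ of facts \[ \mathcal R,\mathcal D\models\mathcal Q \quad\Longleftrightarrow\quad \mathcal D\models\mathcal Q'. \] \textbf{Theorem.} Every finite set of connected domain restricted existential rules is a finite unification set. -/

import Mathlib

universe u

namespace ExRules

/-- A function-free first-order signature: predicates with their arities, and constants. -/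
structure Signature where
  Pred : Type u
  arity : Pred → ℕ
  Const : Type u

/-- Terms are variables (there are countably many, named by natural numbers) or constants. -/
inductive Term (S : Signature.{u}) : Type u
  | var (x : ℕ) : Term S
  | const (c : S.Const) : Term S

/-- An atom `a(t₁, …, tₙ)`, where `n` is the arity of `a`. -/
structure Atom (S : Signature.{u}) : Type u where
  pred : S.Pred
  args : Fin (S.arity pred) → Term S

/-- The set of variables of an atom. -/
def Atom.vars {S : Signature.{u}} (A : Atom S) : Set ℕ := {x | ∃ i, A.args i = Term.var x}

/-- A conjunctive set formula of atoms: a finite set of atoms, read as their conjunction. -/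
abbrev CSF (S : Signature.{u}) : Type u := Finset (Atom S)

/-- The set of variables of a conjunctive set formula. -/
def CSF.vars {S : Signature.{u}} (F : CSF S) : Set ℕ := {x | ∃ A ∈ F, x ∈ A.vars}

/-! ### Connected components -/

/-- `u` and `v` are connected in `F`: the least transitive relation that relates any two variables
of a common atom of `F`. -/
def CSF.Linked {S : Signature.{u}} (F : CSF S) : ℕ → ℕ → Prop :=
  Relation.TransGen fun x y => ∃ A ∈ F, x ∈ A.vars ∧ y ∈ A.vars

/-- A formula is connected if it consists of a single atom without variables, or if it is nonempty,
each of its atoms contains a variable, and all its variables are connected to each other. -/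
def CSF.IsConnected {S : Signature.{u}} (F : CSF S) : Prop :=
  (∃ A : Atom S, A.vars = ∅ ∧ F = {A}) ∨
    (F.Nonempty ∧ (∀ A ∈ F, A.vars.Nonempty) ∧ ∀ x ∈ F.vars, ∀ y ∈ F.vars, F.Linked x y)

/-- The connected components of `F` are its maximal connected subformulas. -/
def CSF.IsComponent {S : Signature.{u}} (F C : CSF S) : Prop :=
  Maximal (fun U : CSF S => U ⊆ F ∧ U.IsConnected) C

/-! ### Rules and queries -/

/-- The existential rule `∀ X, ∃ Y, body → head`, where `X = vars(body)` and
`Y = vars(head) \ vars(body)`. -/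
structure ExistentialRule (S : Signature.{u}) : Type u where
  body : CSF S
  head : CSF S

/-- Connected domain restricted rules: each head atom contains none or all of the variables of each
connected component of the body. -/
def ExistentialRule.IsCdr {S : Signature.{u}} (r : ExistentialRule S) : Prop :=
  ∀ C : CSF S, r.body.IsComponent C → ∀ h ∈ r.head,
    Disjoint C.vars h.vars ∨ C.vars ⊆ h.vars

/-- A Boolean conjunctive query; all its variables are existentially quantified. -/
abbrev CQ (S : Signature.{u}) : Type u := CSF S

/-- A union of conjunctive queries: a finite set of conjunctive queries, read as their
disjunction. -/
abbrev UCQ (S : Signature.{u}) : Type u := Finset (CQ S)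

/-- A fact is a conjunctive set formula of atoms; all its variables are existentially quantified. -/
abbrev Fact (S : Signature.{u}) : Type u := CSF S

/-! ### First-order semantics -/

/-- First-order interpretations of a signature, with nonempty domain. -/
structure Interpretation (S : Signature.{u}) : Type (u + 1) where
  Dom : Type u
  nonempty : Nonempty Dom
  const : S.Const → Dom
  rel : (p : S.Pred) → (Fin (S.arity p) → Dom) → Prop

namespace Interpretation

variable {S : Signature.{u}} (I : Interpretation S)

/-- The value of a term under an assignment of the variables. -/
def eval (σ : ℕ → I.Dom) : Term S → I.Dom
  | Term.var x => σ x
  | Term.const c => I.const c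

/-- Truth of an atom under an assignment of the variables. -/
def SatAtom (σ : ℕ → I.Dom) (A : Atom S) : Prop := I.rel A.pred fun i => I.eval σ (A.args i)

/-- Truth of a conjunctive set formula under an assignment of the variables. -/
def SatCSF (σ : ℕ → I.Dom) (F : CSF S) : Prop := ∀ A ∈ F, I.SatAtom σ A

/-- Truth of the existential closure of a conjunctive set formula (a fact or a query). -/
def SatEx (F : CSF S) : Prop := ∃ σ : ℕ → I.Dom, I.SatCSF σ F

/-- Truth of a union of conjunctive queries. -/
def SatUCQ (Q : UCQ S) : Prop := ∃ q ∈ Q, I.SatEx q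

/-- Truth of an existential rule. -/
def SatRule (r : ExistentialRule S) : Prop :=
  ∀ σ : ℕ → I.Dom, I.SatCSF σ r.body →
    ∃ τ : ℕ → I.Dom, (∀ x ∈ r.body.vars, τ x = σ x) ∧ I.SatCSF τ r.head

end Interpretation

/-- `𝓡, 𝓓 ⊨ 𝓠`: each interpretation in which all the rules and facts are true makes `Q` true. -/
def Entails {S : Signature.{u}} (R : Set (ExistentialRule S)) (D : Set (Fact S)) (Q : UCQ S) :
    Prop :=
  ∀ I : Interpretation S, (∀ r ∈ R, I.SatRule r) → (∀ F ∈ D, I.SatEx F) → I.SatUCQ Q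

/-- `Q'` is a UCQ-rewriting of `Q` with respect to `R`. -/
def IsRewriting {S : Signature.{u}} (R : Set (ExistentialRule S)) (Q Q' : UCQ S) : Prop :=
  ∀ D : Set (Fact S), Entails ∅ D Q' → Entails R D Q

/-- `Q'` is a complete UCQ-rewriting of `Q` with respect to `R`. -/
def IsCompleteRewriting {S : Signature.{u}} (R : Set (ExistentialRule S)) (Q Q' : UCQ S) : Prop :=
  IsRewriting R Q Q' ∧ ∀ D : Set (Fact S), Entails R D Q → Entails ∅ D Q'

/-- `R` is a finite unification set: each union of conjunctive queries has a complete UCQ-rewriting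
with respect to `R` (finite, since a `UCQ` is a finite set of finite queries). -/
def IsFus {S : Signature.{u}} (R : Set (ExistentialRule S)) : Prop :=
  ∀ Q : UCQ S, ∃ Q' : UCQ S, IsCompleteRewriting R Q Q'

end ExRules

namespace ExRules

/-! Let `N` bound the variables of all rule bodies and of `Q`. Over a finite signature there are
finitely many queries with variables below `N`. The rewriting consists of the conjunctions of such
queries that, together with `R`, entail `Q`. It is sound by construction. For completeness, let `M`
be a model of the facts and `J` a model of `R` satisfying every such query true in `M`. The chase of
`M` is a model of `R` and of the facts, so it satisfies some `q ∈ Q`; it remains to transfer `q` to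
`J` (`satEx_of_chase`).

The invariant over chase stages is `LocalHom`: any `N` elements map to `J`, preserving the atoms
over them and the constants. It starts at stage 0 by the choice of `J` (`localHom_zero`). In a chase
step (`localHom_succ`), cdr makes a new atom over `E` contain all or none of the images of each body
component. Components inside `E` follow the old map, the others may be matched anywhere in `J`
(`LocalHom.exists_body`), and applying the rule in `J` gives values for the new nulls. The bound `N`
never grows. -/

/-! ### Conjunctions of queries and finiteness of bounded queries -/

/-- Apply a renaming of the variables to an atom. -/
def Atom.rename {S : Signature.{u}} (f : ℕ → ℕ) (A : Atom S) : Atom S where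
  pred := A.pred
  args i := match A.args i with
    | Term.var x => Term.var (f x)
    | Term.const c => Term.const c

theorem Interpretation.satAtom_rename {S : Signature.{u}} (I : Interpretation S) (f : ℕ → ℕ)
    (σ : ℕ → I.Dom) (A : Atom S) : I.SatAtom σ (A.rename f) ↔ I.SatAtom (σ ∘ f) A := by
  have h : (fun i => I.eval σ ((A.rename f).args i)) = fun i => I.eval (σ ∘ f) (A.args i) := by
    funext i
    change I.eval σ (match A.args i with
      | Term.var x => Term.var (f x)
      | Term.const c => Term.const c) = _
    cases A.args i <;> rfl
  exact iff_of_eq (congrArg (I.rel A.pred) h)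

/-- The conjunction of two queries, with variables renamed apart, is a query. -/
theorem exists_conj {S : Signature.{u}} (q₁ q₂ : CQ S) :
    ∃ q : CQ S, ∀ I : Interpretation S, I.SatEx q ↔ I.SatEx q₁ ∧ I.SatEx q₂ := by
  classical
  -- Even variables serve `q₁` and odd ones `q₂`.
  refine ⟨q₁.image (Atom.rename fun x => 2 * x) ∪ q₂.image (Atom.rename fun x => 2 * x + 1),
    fun I => ⟨?_, ?_⟩⟩
  · rintro ⟨σ, hσ⟩
    exact ⟨⟨_, fun A hA => (I.satAtom_rename _ σ A).1
        (hσ _ (Finset.mem_union_left _ (Finset.mem_image_of_mem _ hA)))⟩,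
      ⟨_, fun A hA => (I.satAtom_rename _ σ A).1
        (hσ _ (Finset.mem_union_right _ (Finset.mem_image_of_mem _ hA)))⟩⟩
  · rintro ⟨⟨σ, hσ⟩, ⟨τ, hτ⟩⟩
    let ρ : ℕ → I.Dom := fun x => if x % 2 = 0 then σ (x / 2) else τ (x / 2)
    have h₁ : (ρ ∘ fun x => 2 * x) = σ := by
      funext x
      simp [ρ]
    have h₂ : (ρ ∘ fun x => 2 * x + 1) = τ := by
      funext x
      have h : (2 * x + 1) / 2 = x := by omega
      simp [ρ, h, Nat.add_mod]
    refine ⟨ρ, fun A hA => ?_⟩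
    rcases Finset.mem_union.1 hA with hA | hA
    · obtain ⟨B, hB, rfl⟩ := Finset.mem_image.1 hA
      rw [I.satAtom_rename, h₁]
      exact hσ B hB
    · obtain ⟨B, hB, rfl⟩ := Finset.mem_image.1 hA
      rw [I.satAtom_rename, h₂]
      exact hτ B hB

/-- Finite conjunctions of queries are queries. -/
theorem exists_finset_conj {S : Signature.{u}} (Θ : Finset (CQ S)) :
    ∃ q : CQ S, ∀ I : Interpretation S, I.SatEx q ↔ ∀ c ∈ Θ, I.SatEx c := by
  classical
  induction Θ using Finset.induction_on with
  | empty =>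
    refine ⟨∅, fun I => ⟨fun _ c hc => absurd hc (Finset.notMem_empty c), fun _ => ?_⟩⟩
    exact ⟨fun _ => I.nonempty.some, fun A hA => absurd hA (Finset.notMem_empty A)⟩
  | insert c Θ _ ih =>
    obtain ⟨q, hq⟩ := ih
    obtain ⟨q', hq'⟩ := exists_conj c q
    exact ⟨q', fun I => by rw [hq', hq, Finset.forall_mem_insert]⟩

/-- Over a finite signature there are finitely many atoms with variables below `N`. -/
theorem finite_atoms_lt (S : Signature.{u}) [Finite S.Pred] [Finite S.Const] (N : ℕ) :
    {A : Atom S | ∀ x ∈ A.vars, x < N}.Finite := by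
  let toTerm : Fin N ⊕ S.Const → Term S := Sum.elim (fun x => Term.var x) Term.const
  let f : (Σ p : S.Pred, Fin (S.arity p) → Fin N ⊕ S.Const) → Atom S :=
    fun a => ⟨a.1, fun i => toTerm (a.2 i)⟩
  refine (Set.finite_range f).subset fun A hA => ?_
  have h : ∀ i, ∃ t, toTerm t = A.args i := by
    intro i
    cases hi : A.args i with
    | var x => exact ⟨Sum.inl ⟨x, hA x ⟨i, hi⟩⟩, rfl⟩
    | const c => exact ⟨Sum.inr c, rfl⟩
  choose t ht using h
  refine ⟨⟨A.pred, t⟩, ?_⟩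
  change Atom.mk A.pred (fun i => toTerm (t i)) = A
  rw [funext ht]

/-- The variables of a formula are bounded. -/
theorem CSF.exists_vars_lt {S : Signature.{u}} (F : CSF S) : ∃ N, ∀ x ∈ F.vars, x < N := by
  have hfin : F.vars.Finite := by
    have h : F.vars = ⋃ A ∈ F, A.vars := by
      ext x
      simp [CSF.vars]
    rw [h]
    refine F.finite_toSet.biUnion fun A _ => ?_
    refine ((Set.finite_range A.args).preimage
      (f := fun x : ℕ => (Term.var x : Term S)) fun x _ y _ h => by simpa using h).subset ?_
    rintro x ⟨i, hi⟩
    exact ⟨i, hi⟩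
  obtain ⟨N, hN⟩ := hfin.bddAbove
  exact ⟨N + 1, fun x hx => Nat.lt_succ_of_le (hN hx)⟩

theorem exists_vars_lt_of_finite {S : Signature.{u}} {s : Set (CSF S)} (hs : s.Finite) :
    ∃ N, ∀ F ∈ s, ∀ x ∈ F.vars, x < N := by
  choose b hb using fun F : CSF S => F.exists_vars_lt
  obtain ⟨N, hN⟩ := (hs.image b).bddAbove
  exact ⟨N, fun F hF x hx => (hb F x hx).trans_le (hN ⟨F, hF, rfl⟩)⟩

/-! ### Connected components and the cdr condition -/

theorem CSF.Linked.mono {S : Signature.{u}} {F G : CSF S} (h : F ⊆ G) {x y : ℕ}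
    (hxy : F.Linked x y) : G.Linked x y :=
  Relation.TransGen.mono (fun _ _ ⟨A, hA, h'⟩ => ⟨A, h hA, h'⟩) _ _ hxy

theorem CSF.Linked.symm {S : Signature.{u}} {F : CSF S} {x y : ℕ}
    (hxy : F.Linked x y) : F.Linked y x := by
  induction hxy with
  | single h =>
    obtain ⟨A, hA, hx, hy⟩ := h
    exact .single ⟨A, hA, hy, hx⟩
  | tail _ h ih =>
    obtain ⟨A, hA, hx, hy⟩ := h
    exact .head ⟨A, hA, hy, hx⟩ ih

/-- Every variable of a formula lies in a connected component that contains all the variables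
linked to it. -/
theorem CSF.exists_component {S : Signature.{u}} (F : CSF S) {x : ℕ} (hx : x ∈ F.vars) :
    ∃ C, F.IsComponent C ∧ ∀ y, F.Linked x y → y ∈ C.vars := by
  classical
  obtain ⟨A₀, hA₀, hxA₀⟩ := hx
  let C : CSF S := F.filter fun A => ∃ y ∈ A.vars, F.Linked x y
  have hCF : C ⊆ F := Finset.filter_subset _ _
  have hxx : F.Linked x x := .single ⟨A₀, hA₀, hxA₀, hxA₀⟩
  -- Every atom on a chain of links from `x` is itself in `C`.
  have hlink : ∀ y, F.Linked x y → C.Linked x y := by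
    intro y hy
    induction hy with
    | single h =>
      obtain ⟨A, hA, hx, hy⟩ := h
      exact .single ⟨A, Finset.mem_filter.2 ⟨hA, x, hx, hxx⟩, hx, hy⟩
    | tail hxb h ih =>
      obtain ⟨A, hA, hb, hy⟩ := h
      exact ih.tail ⟨A, Finset.mem_filter.2 ⟨hA, _, hb, hxb⟩, hb, hy⟩
  have hvars : ∀ y ∈ C.vars, F.Linked x y := by
    rintro y ⟨A, hA, hy⟩
    obtain ⟨hA, z, hz, hxz⟩ := Finset.mem_filter.1 hA
    exact hxz.tail ⟨A, hA, hz, hy⟩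
  have hA₀C : A₀ ∈ C := Finset.mem_filter.2 ⟨hA₀, x, hxA₀, hxx⟩
  refine ⟨C, ⟨⟨hCF, Or.inr ⟨⟨A₀, hA₀C⟩, ?_, ?_⟩⟩, ?_⟩, ?_⟩
  · intro A hA
    obtain ⟨_, y, hy, _⟩ := Finset.mem_filter.1 hA
    exact ⟨y, hy⟩
  · intro y hy z hz
    exact (hlink y (hvars y hy)).symm.trans (hlink z (hvars z hz))
  · rintro U ⟨hUF, hU⟩ hCU A hA
    rcases hU with ⟨A', hA', rfl⟩ | ⟨_, hne, hU⟩
    · have h : A₀ = A' := Finset.mem_singleton.1 (hCU hA₀C)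
      subst h
      rw [hA'] at hxA₀
      exact hxA₀.elim
    · obtain ⟨y, hy⟩ := hne A hA
      exact Finset.mem_filter.2 ⟨hUF hA, y, hy,
        (hU x ⟨A₀, hCU hA₀C, hxA₀⟩ y ⟨A, hA, hy⟩).mono hUF⟩
  · intro y hy
    obtain ⟨z, -, A, hA, hz, hy'⟩ := Relation.TransGen.tail'_iff.1 (hlink y hy)
    exact ⟨A, hA, hy'⟩

/-- The only form in which cdr is used: the component of `x` meets `h`, hence lies within it. -/
theorem ExistentialRule.IsCdr.mem_vars_of_linked {S : Signature.{u}} {r : ExistentialRule S}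
    (hr : r.IsCdr) {h : Atom S} (hh : h ∈ r.head) {x y : ℕ} (hxB : x ∈ r.body.vars)
    (hx : x ∈ h.vars) (hxy : r.body.Linked x y) : y ∈ h.vars := by
  obtain ⟨C, hC, hCx⟩ := r.body.exists_component hxB
  have hxx : r.body.Linked x x := by
    obtain ⟨A, hA, hxA⟩ := hxB
    exact .single ⟨A, hA, hxA, hxA⟩
  rcases hr C hC h hh with hd | hs
  · exact (Set.disjoint_left.1 hd (hCx x hxx) hx).elim
  · exact hs (hCx y hxy)

/-! ### The Skolem chase -/

/-- Terms over the constants of `S` and the elements of `D`, with a null for each instance of a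
rule and each variable. -/
inductive SkolemTerm (S : Signature.{u}) (D : Type u) : Type u
  | const (c : S.Const) : SkolemTerm S D
  | base (d : D) : SkolemTerm S D
  | null (r : ExistentialRule S) (σ : ℕ → SkolemTerm S D) (y : ℕ) : SkolemTerm S D

namespace SkolemTerm

variable {S : Signature.{u}}

/-- The value of a term under an assignment of Skolem terms. -/
def eval {D : Type u} (σ : ℕ → SkolemTerm S D) : Term S → SkolemTerm S D
  | Term.var x => σ x
  | Term.const c => const c

/-- Truth of an atom in a relational structure on Skolem terms. -/
def Holds {D : Type u} (rel : (p : S.Pred) → (Fin (S.arity p) → SkolemTerm S D) → Prop)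
    (σ : ℕ → SkolemTerm S D) (A : Atom S) : Prop :=
  rel A.pred fun i => eval σ (A.args i)

open Classical in
/-- The extension of an assignment of the body variables to the head variables of a rule. -/
noncomputable def extend {D : Type u} (r : ExistentialRule S) (σ : ℕ → SkolemTerm S D) (x : ℕ) :
    SkolemTerm S D :=
  if x ∈ r.body.vars then σ x else null r σ x

/-- The predicate "not a null". -/
def IsGround {D : Type u} : SkolemTerm S D → Prop
  | const _ => True
  | base _ => True
  | null _ _ _ => False

/-- The value of a Skolem term in an interpretation; the value of a null is irrelevant. -/
noncomputable def proj (M : Interpretation S) : SkolemTerm S M.Dom → M.Dom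
  | const c => M.const c
  | base d => d
  | null _ _ _ => M.nonempty.some

end SkolemTerm

open SkolemTerm

variable {S : Signature.{u}}

/-- One parallel chase step. -/
inductive ChaseStep {D : Type u} (R : Set (ExistentialRule S))
    (rel : (p : S.Pred) → (Fin (S.arity p) → SkolemTerm S D) → Prop) :
    (p : S.Pred) → (Fin (S.arity p) → SkolemTerm S D) → Prop
  | old (p : S.Pred) (a : Fin (S.arity p) → SkolemTerm S D) : rel p a → ChaseStep R rel p a
  | new (r : ExistentialRule S) (σ : ℕ → SkolemTerm S D) (h : Atom S) : r ∈ R →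
      (∀ A ∈ r.body, Holds rel σ A) → h ∈ r.head →
      ChaseStep R rel h.pred fun i => eval (extend r σ) (h.args i)

/-- The stages of the Skolem chase of `M`. -/
def chaseRel (R : Set (ExistentialRule S)) (M : Interpretation S) :
    ℕ → (p : S.Pred) → (Fin (S.arity p) → SkolemTerm S M.Dom) → Prop
  | 0 => fun p a => (∀ i, (a i).IsGround) ∧ M.rel p fun i => proj M (a i)
  | n + 1 => ChaseStep R (chaseRel R M n)

theorem chaseRel_mono {R : Set (ExistentialRule S)} {M : Interpretation S} {m n : ℕ} (h : m ≤ n)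
    {p : S.Pred} {a : Fin (S.arity p) → SkolemTerm S M.Dom} (ha : chaseRel R M m p a) :
    chaseRel R M n p a := by
  induction h with
  | refl => exact ha
  | step _ ih => exact ChaseStep.old _ _ ih

/-- A null occurs in a stage only if its rule instance has been applied. -/
theorem holds_head_of_null {R : Set (ExistentialRule S)} {M : Interpretation S} (n : ℕ) :
    ∀ {p : S.Pred} {a : Fin (S.arity p) → SkolemTerm S M.Dom}, chaseRel R M n p a →
      ∀ {i r σ y}, a i = null r σ y → ∀ h ∈ r.head,
        Holds (chaseRel R M n) (extend r σ) h := by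
  induction n with
  | zero =>
    intro p a ha i r σ y hi
    have h := ha.1 i
    rw [hi] at h
    exact h.elim
  | succ n ih =>
    intro p a ha i r σ y hi h hh
    cases ha with
    | old _ _ ha => exact ChaseStep.old _ _ (ih ha hi h hh)
    | new r' σ' h' hr' hσ' hh' =>
      change eval (extend r' σ') (h'.args i) = _ at hi
      cases ht : h'.args i with
      | const c =>
        rw [ht] at hi
        cases hi
      | var x =>
        rw [ht] at hi
        change extend r' σ' x = _ at hi
        unfold extend at hi
        split_ifs at hi with hx
        -- The null was copied from a body atom, so it occurred at the previous stage.
        · obtain ⟨A, hA, j, hj⟩ := hx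
          refine ChaseStep.old _ _ (ih (hσ' A hA) (i := j) (y := y) ?_ h hh)
          rw [hj]
          exact hi
        -- A fresh null records its rule and assignment, so the instance is the one being applied
        -- now.
        · injection hi with h₁ h₂ h₃
          subst h₁ h₂
          exact ChaseStep.new _ _ _ hr' hσ' hh

/-- The Skolem chase of `M`. -/
def chase (R : Set (ExistentialRule S)) (M : Interpretation S) : Interpretation S where
  Dom := SkolemTerm S M.Dom
  nonempty := M.nonempty.map base
  const := const
  rel p a := ∃ n, chaseRel R M n p a

theorem chase_eval (R : Set (ExistentialRule S)) (M : Interpretation S)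
    (σ : ℕ → SkolemTerm S M.Dom) (t : Term S) : (chase R M).eval σ t = eval σ t := by
  cases t <;> rfl

theorem chase_satAtom {R : Set (ExistentialRule S)} {M : Interpretation S}
    {σ : ℕ → SkolemTerm S M.Dom} {A : Atom S} :
    (chase R M).SatAtom σ A ↔ ∃ n, Holds (chaseRel R M n) σ A := by
  have h : (fun i => (chase R M).eval σ (A.args i)) = fun i => eval σ (A.args i) :=
    funext fun i => chase_eval R M σ _
  exact iff_of_eq (congrArg ((chase R M).rel A.pred) h)

theorem chase_satCSF {R : Set (ExistentialRule S)} {M : Interpretation S}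
    {σ : ℕ → SkolemTerm S M.Dom} {F : CSF S} (hF : (chase R M).SatCSF σ F) :
    ∃ n, ∀ A ∈ F, Holds (chaseRel R M n) σ A := by
  classical
  choose! k hk using fun A hA => chase_satAtom.1 (hF A hA)
  exact ⟨F.sup k, fun A hA => chaseRel_mono (Finset.le_sup hA) (hk A hA)⟩

theorem chase_satRule {R : Set (ExistentialRule S)} (M : Interpretation S)
    {r : ExistentialRule S} (hr : r ∈ R) : (chase R M).SatRule r := by
  intro σ hσ
  obtain ⟨n, hn⟩ := chase_satCSF hσ
  refine ⟨extend r σ, fun x hx => if_pos hx, fun h hh => chase_satAtom.2 ⟨n + 1, ?_⟩⟩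
  exact ChaseStep.new r σ h hr hn hh

theorem chase_satEx (R : Set (ExistentialRule S)) {M : Interpretation S} {F : CSF S}
    (hF : M.SatEx F) : (chase R M).SatEx F := by
  obtain ⟨σ, hσ⟩ := hF
  refine ⟨fun x => base (σ x), fun A hA => chase_satAtom.2 ⟨0, fun i => ?_, ?_⟩⟩
  · change (eval (fun x => base (σ x)) (A.args i)).IsGround
    cases A.args i <;> trivial
  · have h : (fun i => proj M (eval (fun x => base (σ x)) (A.args i))) =
        fun i => M.eval σ (A.args i) := by
      funext i
      cases A.args i <;> rfl
    exact (congrArg (M.rel A.pred) h).mpr (hσ A hA)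

/-! ### Transfer of small queries -/

/-- `t` is a constant or belongs to `E`. -/
def InScope {D : Type u} (E : Finset (SkolemTerm S D)) (t : SkolemTerm S D) : Prop :=
  t ∈ E ∨ ∃ c, t = const c

/-- Each set of at most `N` elements has a map to `J` that preserves the constants and all atoms
over that set and the constants. -/
def LocalHom {D : Type u} (N : ℕ)
    (rel : (p : S.Pred) → (Fin (S.arity p) → SkolemTerm S D) → Prop)
    (J : Interpretation S) : Prop :=
  ∀ E : Finset (SkolemTerm S D), E.card ≤ N → ∃ g : SkolemTerm S D → J.Dom,
    (∀ c, g (const c) = J.const c) ∧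
      ∀ p a, (∀ i, InScope E (a i)) → rel p a → J.rel p fun i => g (a i)

/-- Local homomorphisms transfer queries with variables below `N`. -/
theorem LocalHom.satEx {D : Type u} {N : ℕ}
    {rel : (p : S.Pred) → (Fin (S.arity p) → SkolemTerm S D) → Prop} {J : Interpretation S}
    (hJ : LocalHom N rel J) {F : CSF S} (hF : ∀ x ∈ F.vars, x < N) {σ : ℕ → SkolemTerm S D}
    (hσ : ∀ A ∈ F, Holds rel σ A) : J.SatEx F := by
  classical
  obtain ⟨g, hgc, hg⟩ := hJ ((Finset.range N).image σ)
    (Finset.card_image_le.trans (Finset.card_range N).le)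
  refine ⟨fun x => g (σ x), fun A hA => ?_⟩
  have h : (fun i => J.eval (fun x => g (σ x)) (A.args i)) = fun i => g (eval σ (A.args i)) := by
    funext i
    cases A.args i with
    | var x => rfl
    | const c => exact (hgc c).symm
  refine (congrArg (J.rel A.pred) h).mpr (hg _ _ (fun i => ?_) (hσ A hA))
  cases hi : A.args i with
  | var x =>
    exact Or.inl (Finset.mem_image_of_mem _ (Finset.mem_range.2 (hF x ⟨A, hA, i, hi⟩)))
  | const c => exact Or.inr ⟨c, rfl⟩

/-- Describe `E` by one query: all atoms with variables below `N` true in `M` when the variables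
enumerate `E`. Its match in `J` gives the map. -/
theorem localHom_zero [Finite S.Pred] [Finite S.Const] (R : Set (ExistentialRule S)) {N : ℕ}
    {M J : Interpretation S}
    (h : ∀ F : CSF S, (∀ A ∈ F, ∀ x ∈ A.vars, x < N) → M.SatEx F → J.SatEx F) :
    LocalHom N (chaseRel R M 0) J := by
  classical
  intro E hE
  let e := E.equivFin
  let τ : ℕ → M.Dom := fun x =>
    if hx : x < E.card then proj M (e.symm ⟨x, hx⟩) else M.nonempty.some
  -- Constants stay constants even when they lie in `E`; `Term.var N` is a junk value outside the
  -- scope.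
  let s : SkolemTerm S M.Dom → Term S := fun t => match t with
    | const c => Term.const c
    | t => if ht : t ∈ E then Term.var (e ⟨t, ht⟩) else Term.var N
  have hs : ∀ t, InScope E t → M.eval τ (s t) = proj M t ∧ ∀ x, s t = Term.var x → x < N := by
    have key : ∀ (t) (ht : t ∈ E), M.eval τ (Term.var (e ⟨t, ht⟩)) = proj M t ∧
        ∀ x, (Term.var (e ⟨t, ht⟩) : Term S) = Term.var x → x < N := by
      intro t ht
      constructor
      · simp [τ, Interpretation.eval]
      · intro x hx
        injection hx with hx
        rw [← hx]
        exact (e ⟨t, ht⟩).2.trans_le hE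
    intro t ht
    cases t with
    | const c => exact ⟨rfl, fun x hx => by cases hx⟩
    | base d =>
      have ht' : base d ∈ E := ht.resolve_right (by rintro ⟨c, hc⟩; cases hc)
      have hst : s (base d) = Term.var (e ⟨_, ht'⟩) := dif_pos ht'
      rw [hst]
      exact key _ ht'
    | null r σ y =>
      have ht' : null r σ y ∈ E := ht.resolve_right (by rintro ⟨c, hc⟩; cases hc)
      have hst : s (null r σ y) = Term.var (e ⟨_, ht'⟩) := dif_pos ht'
      rw [hst]
      exact key _ ht'
  let F : CSF S := (finite_atoms_lt S N).toFinset.filter fun A => M.SatAtom τ A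
  have hF : ∀ A, A ∈ F ↔ (∀ x ∈ A.vars, x < N) ∧ M.SatAtom τ A := by
    intro A
    simp [F]
  obtain ⟨τ', hτ'⟩ := h F (fun A hA => ((hF A).1 hA).1) ⟨τ, fun A hA => ((hF A).1 hA).2⟩
  refine ⟨fun t => J.eval τ' (s t), fun c => rfl, fun p a ha hp => ?_⟩
  refine hτ' ⟨p, fun i => s (a i)⟩ ((hF _).2 ⟨?_, ?_⟩)
  · rintro x ⟨i, hi⟩
    exact (hs _ (ha i)).2 x hi
  · have heq : (fun i => M.eval τ (s (a i))) = fun i => proj M (a i) :=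
      funext fun i => (hs _ (ha i)).1
    exact (congrArg (M.rel p) heq).mpr hp.2

/-- The body of an applicable rule instance is satisfied in `J` by an assignment that follows `g`
on the variables all of whose linked variables are in scope. -/
theorem LocalHom.exists_body {D : Type u} {N : ℕ}
    {rel : (p : S.Pred) → (Fin (S.arity p) → SkolemTerm S D) → Prop} {J : Interpretation S}
    (hJ : LocalHom N rel J) {B : CSF S} (hB : ∀ x ∈ B.vars, x < N) {σ : ℕ → SkolemTerm S D}
    (hσ : ∀ A ∈ B, Holds rel σ A) {E : Finset (SkolemTerm S D)} {g : SkolemTerm S D → J.Dom}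
    (hgc : ∀ c, g (const c) = J.const c)
    (hg : ∀ p a, (∀ i, InScope E (a i)) → rel p a → J.rel p fun i => g (a i)) :
    ∃ σ' : ℕ → J.Dom, J.SatCSF σ' B ∧
      ∀ x, (∀ y, B.Linked x y → InScope E (σ y)) → σ' x = g (σ x) := by
  classical
  -- This match uses a local map for the image of `σ`, unrelated to `g`.
  obtain ⟨σ₀, hσ₀⟩ := hJ.satEx hB hσ
  refine ⟨fun x => if ∀ y, B.Linked x y → InScope E (σ y) then g (σ x) else σ₀ x, ?_,
    fun x hx => if_pos hx⟩
  intro A hA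
  -- Variables of one atom are linked, so the atom follows `g` entirely or `σ₀` entirely.
  by_cases hall : ∀ x ∈ A.vars, ∀ y, B.Linked x y → InScope E (σ y)
  · have h : (fun i => J.eval (fun x => if ∀ y, B.Linked x y → InScope E (σ y) then g (σ x)
        else σ₀ x) (A.args i)) = fun i => g (eval σ (A.args i)) := by
      funext i
      cases hi : A.args i with
      | var x => exact if_pos (hall x ⟨i, hi⟩)
      | const c => exact (hgc c).symm
    refine (congrArg (J.rel A.pred) h).mpr (hg _ _ (fun i => ?_) (hσ A hA))
    cases hi : A.args i with
    | var x => exact hall x ⟨i, hi⟩ x (.single ⟨A, hA, ⟨i, hi⟩, ⟨i, hi⟩⟩)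
    | const c => exact Or.inr ⟨c, rfl⟩
  · have h : (fun i => J.eval (fun x => if ∀ y, B.Linked x y → InScope E (σ y) then g (σ x)
        else σ₀ x) (A.args i)) = fun i => J.eval σ₀ (A.args i) := by
      funext i
      cases hi : A.args i with
      | var x =>
        refine if_neg fun hx => hall fun z hz y hzy => hx y (.head ?_ hzy)
        exact ⟨A, hA, ⟨i, hi⟩, hz⟩
      | const c => rfl
    exact (congrArg (J.rel A.pred) h).mpr (hσ₀ A hA)

/-- Chase steps with cdr rules preserve local homomorphisms to a model of the rules. -/
theorem localHom_succ {R : Set (ExistentialRule S)} (hcdr : ∀ r ∈ R, r.IsCdr) {N : ℕ}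
    (hN : ∀ r ∈ R, ∀ x ∈ r.body.vars, x < N) {M J : Interpretation S}
    (hJR : ∀ r ∈ R, J.SatRule r) {n : ℕ} (hJ : LocalHom N (chaseRel R M n) J) :
    LocalHom N (chaseRel R M (n + 1)) J := by
  classical
  intro E hE
  obtain ⟨g, hgc, hg⟩ := hJ E hE
  -- One `τ` is fixed per rule instance, so that all head atoms sharing a null agree on its value.
  have hτ : ∀ (r : ExistentialRule S) (σ : ℕ → SkolemTerm S M.Dom), ∃ τ : ℕ → J.Dom,
      r ∈ R → (∀ A ∈ r.body, Holds (chaseRel R M n) σ A) → J.SatCSF τ r.head ∧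
        ∀ x ∈ r.body.vars, (∀ y, r.body.Linked x y → InScope E (σ y)) → τ x = g (σ x) := by
    intro r σ
    by_cases h : r ∈ R ∧ ∀ A ∈ r.body, Holds (chaseRel R M n) σ A
    · obtain ⟨σ', hσ', hσg⟩ := hJ.exists_body (hN r h.1) h.2 hgc hg
      obtain ⟨τ, hτ, hτh⟩ := hJR r h.1 σ' hσ'
      exact ⟨τ, fun _ _ => ⟨hτh, fun x hx hxE => (hτ x hx).trans (hσg x hxE)⟩⟩
    · exact ⟨fun _ => J.nonempty.some, fun h₁ h₂ => (h ⟨h₁, h₂⟩).elim⟩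
  choose τ hτ using hτ
  let Occ : SkolemTerm S M.Dom → Prop := fun t => ∃ p a i, chaseRel R M n p a ∧ a i = t
  -- Elements occurring at stage `n` keep their image; any other null takes the value chosen for its
  -- rule instance.
  let g' : SkolemTerm S M.Dom → J.Dom := fun t => if Occ t then g t else match t with
    | null r σ y => τ r σ y
    | t => g t
  have hg'c : ∀ c, g' (const c) = J.const c := by
    intro c
    have : g' (const c) = g (const c) := ite_self _
    rw [this, hgc]
  have hold : ∀ p a, (∀ i, InScope E (a i)) → chaseRel R M n p a →
      J.rel p fun i => g' (a i) := by
    intro p a ha hp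
    have h : (fun i => g' (a i)) = fun i => g (a i) :=
      funext fun i => if_pos ⟨p, a, i, hp, rfl⟩
    rw [h]
    exact hg p a ha hp
  refine ⟨g', hg'c, fun p a ha hp => ?_⟩
  by_cases hpn : chaseRel R M n p a
  · exact hold p a ha hpn
  cases hp with
  | old _ _ hp => exact hold p a ha hp
  | new r σ h hr hσ hh =>
    obtain ⟨hτh, hτg⟩ := hτ r σ hr hσ
    have heq : (fun i => g' (eval (extend r σ) (h.args i))) =
        fun i => J.eval (τ r σ) (h.args i) := by
      funext i
      cases hi : h.args i with
      | const c => exact hg'c c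
      | var x =>
        change g' (extend r σ x) = τ r σ x
        by_cases hx : x ∈ r.body.vars
        · have hext : extend r σ x = σ x := if_pos hx
          have hocc : Occ (σ x) := by
            obtain ⟨A, hA, j, hj⟩ := hx
            refine ⟨_, _, j, hσ A hA, ?_⟩
            rw [hj]
            rfl
          have hgσ : g' (σ x) = g (σ x) := if_pos hocc
          rw [hext, hgσ, hτg x hx]
          -- By cdr, `y` also occurs in `h`, and all arguments of the new atom are in scope.
          intro y hxy
          obtain ⟨j, hj⟩ := (hcdr r hr).mem_vars_of_linked hh hx ⟨i, hi⟩ hxy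
          have hyB : y ∈ r.body.vars := by
            obtain ⟨_, -, A, hA, -, hy⟩ := Relation.TransGen.tail'_iff.1 hxy
            exact ⟨A, hA, hy⟩
          have hy : InScope E (eval (extend r σ) (h.args j)) := ha j
          rw [hj] at hy
          have hexty : extend r σ y = σ y := if_pos hyB
          rw [← hexty]
          exact hy
        · have hext : extend r σ x = null r σ x := if_neg hx
          rw [hext]
          -- Had the null occurred before, its instance would have been applied and the atom would
          -- not be new.
          refine if_neg ?_
          rintro ⟨p, a, j, hpa, hj⟩
          exact hpn (holds_head_of_null n hpa hj h hh)
    rw [heq]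
    exact hτh h hh

/-- Queries with variables below `N` that hold in the chase of `M` hold in each model of the rules
that satisfies all such queries true in `M`. -/
theorem satEx_of_chase [Finite S.Pred] [Finite S.Const] {R : Set (ExistentialRule S)}
    (hcdr : ∀ r ∈ R, r.IsCdr) {N : ℕ} (hN : ∀ r ∈ R, ∀ x ∈ r.body.vars, x < N)
    {M J : Interpretation S} (hJR : ∀ r ∈ R, J.SatRule r)
    (h : ∀ F : CSF S, (∀ A ∈ F, ∀ x ∈ A.vars, x < N) → M.SatEx F → J.SatEx F)
    {q : CQ S} (hq : ∀ x ∈ q.vars, x < N) (hMq : (chase R M).SatEx q) : J.SatEx q := by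
  obtain ⟨σ, hσ⟩ := hMq
  obtain ⟨n, hn⟩ := chase_satCSF hσ
  have hloc : ∀ n, LocalHom N (chaseRel R M n) J := by
    intro n
    induction n with
    | zero => exact localHom_zero R h
    | succ n ih => exact localHom_succ hcdr hN hJR ih
  exact (hloc n).satEx hq hn

end ExRules

/-! ### The rewriting -/

theorem mainTheorem1 (S : ExRules.Signature.{u}) [Finite S.Pred] [Finite S.Const]
    (R : Set (ExRules.ExistentialRule S)) (hfin : R.Finite) (hcdr : ∀ r ∈ R, r.IsCdr) :
    ExRules.IsFus R := by
  classical
  intro Q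
  obtain ⟨N₁, hN₁⟩ := ExRules.exists_vars_lt_of_finite (hfin.image ExRules.ExistentialRule.body)
  obtain ⟨N₂, hN₂⟩ := ExRules.exists_vars_lt_of_finite Q.finite_toSet
  let N := max N₁ N₂
  let K : Finset (ExRules.CQ S) := (ExRules.finite_atoms_lt S N).toFinset.powerset
  have hK : ∀ F : ExRules.CQ S, F ∈ K ↔ ∀ A ∈ F, ∀ x ∈ A.vars, x < N := by
    intro F
    simp [K, Finset.subset_iff]
  choose conj hconj using fun Θ : Finset (ExRules.CQ S) => ExRules.exists_finset_conj Θ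
  refine ⟨(K.powerset.image conj).filter fun c => ExRules.Entails R {c} Q, ?_, ?_⟩
  · intro D hD I hR hI
    obtain ⟨c, hc, hIc⟩ := hD I (fun r hr => absurd hr (Set.notMem_empty r)) hI
    refine (Finset.mem_filter.1 hc).2 I hR ?_
    rintro F rfl
    exact hIc
  · intro D hD M _ hM
    -- `Θ` is the `N`-variable type of `M`; its conjunction is the disjunct that holds in `M`.
    let Θ := K.filter fun F => M.SatEx F
    refine ⟨conj Θ, Finset.mem_filter.2 ⟨Finset.mem_image_of_mem _
      (Finset.mem_powerset.2 (Finset.filter_subset _ _)), ?_⟩,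
      (hconj Θ M).2 fun F hF => (Finset.mem_filter.1 hF).2⟩
    intro J hJR hJ
    have hJΘ := (hconj Θ J).1 (hJ _ rfl)
    obtain ⟨q, hq, hMq⟩ := hD (ExRules.chase R M) (fun r hr => ExRules.chase_satRule M hr)
      fun F hF => ExRules.chase_satEx R (hM F hF)
    exact ⟨q, hq, ExRules.satEx_of_chase hcdr
      (fun r hr x hx => (hN₁ _ ⟨r, hr, rfl⟩ x hx).trans_le (le_max_left _ _)) hJR
      (fun F hF hMF => hJΘ F (Finset.mem_filter.2 ⟨(hK F).2 hF, hMF⟩))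
      (fun x hx => (hN₂ q hq x hx).trans_le (le_max_right _ _)) hMq⟩
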